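/- Let $|\Psi_1\rangle,|\Psi_2\rangle=\frac1{\sqrt2}(|00\rangle\pm|11\rangle)$ and $|\Psi_3\rangle,|\Psi_4\rangle=\frac1{\sqrt2}(|01\rangle\pm|10\rangle)$ be the four Bell states, with density operators $\Psi_i=|\Psi_i\rangle\langle\Psi_i|$. For $\lambda\in[0,1]$ and a two-qubit density operator $\varsigma$ on $\mathcal X_1\otimes\mathcal Y_1$ ($\mathcal X_1=\mathcal Y_1=\mathbb C^2$), pure or mixed, put $\varrho_i=\lambda\Psi_i+(1-\lambda)\varsigma$, $i=1,\dots,4$. For $\varepsilon\in[0,1]$ let $\tau_\varepsilon=|\tau_\varepsilon\rangle\langle\tau_\varepsilon|$ with $|\tau_\varepsilon\rangle=\sqrt{\tfrac{1+\varepsilon}2}\,|00\rangle+\sqrt{\tfrac{1-\varepsilon}2}\,|11\rangle\in\mathcal X_2\otimes\mathcal Y_2$ ($\mathcal X_2=\mathcal Y_2=\mathbb C^2$). Let $\mathcal B_{\lambda,\varsigma}\otimes\tau_\varepsilon$ be the ensemble of the four states $\varrho_i\otimes\tau_\varepsilon$, each with probability $\frac14$, where Alice holds $\mathcal X_1\otimes\mathcal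 X_2$ and Bob holds $\mathcal Y_1\otimes\mathcal Y_2$. Its local success probability is $$p_{\rm L}\left(\mathcal B_{\lambda,\varsigma}\otimes\tau_\varepsilon\right)=\sup_{\{M_i\}}\ \frac14\sum_{i=1}^4\operatorname{Tr}\left((\varrho_i\otimes\tau_\varepsilon)M_i\right),$$ where the supremum is over all measurements $\{M_1,\dots,M_4\}$ that Alice and Bob can implement by a protocol of finitely many rounds of local quantum operations and classical communication (LOCC). Then for all $\varepsilon,\lambda\in[0,1]$ and every two-qubit density operator $\varsigma$, $$p_{\rm L}\left(\mathcal B_{\lambda,\varsigma}\otimes\tau_\varepsilon\right)=\frac14\left(1+\lambda+2\lambda\sqrt{1-\varepsilon^2}\right),$$ and the supremum is attained by such a measurement. -/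

import Mathlib

open scoped Kronecker ComplexOrder

noncomputable section

namespace LOCC

/-- A density operator (quantum state): positive semidefinite with unit trace. -/
def IsDensity {n : Type*} [Fintype n] (ρ : Matrix n n ℂ) : Prop :=
  ρ.PosSemidef ∧ ρ.trace = 1

/-- The operator `|v⟩⟨v|`. -/
def proj {n : Type*} (v : n → ℂ) : Matrix n n ℂ :=
  Matrix.vecMulVec v (star v)

/-- A quantum instrument from the system `ℂ^a`: on the classical outcome `k` the (trace
non-increasing, completely positive) map `X ↦ ∑ j, K k j * X * (K k j)ᴴ` to the system `ℂ^(c k)`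
is applied; the sum of these maps over all outcomes preserves the trace. The output system may
depend on the outcome, so that ancillas may be added and parts of the system discarded. -/
def IsInstrument {a κ γ : Type} [DecidableEq a] [Fintype κ] [Fintype γ] {c : κ → Type}
    [∀ k, Fintype (c k)] (K : ∀ k, γ → Matrix (c k) a ℂ) : Prop :=
  ∑ k, ∑ j, (K k j).conjTranspose * K k j = 1

/-- `IsLOCC a b M`: the family of measurement operators `M i` (`i : ι`) on `ℂ^a ⊗ ℂ^b`
(Alice's system is `ℂ^a`, Bob's is `ℂ^b`) is implemented by a protocol of finitely many rounds of
local operations and classical communication. Such a protocol either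
* ends by announcing a result `i₀`; or
* lets Alice apply an instrument to her system and send its classical outcome `k` to Bob, after
  which the parties continue with an LOCC measurement `N k` of the resulting joint system; or
* does the same with the roles of Alice and Bob exchanged.
In the last two cases the measurement operators of the whole protocol are the images of those of
the continuations under the adjoint of the local map that was applied. -/
inductive IsLOCC {ι : Type} [DecidableEq ι] :
    ∀ (a b : Type) [Fintype a] [DecidableEq a] [Fintype b] [DecidableEq b],
      (ι → Matrix (a × b) (a × b) ℂ) → Prop
  | announce (a b : Type) [Fintype a] [DecidableEq a] [Fintype b] [DecidableEq b] (i₀ : ι) :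
      IsLOCC a b (fun i => if i = i₀ then 1 else 0)
  | alice (a b : Type) [Fintype a] [DecidableEq a] [Fintype b] [DecidableEq b]
      {κ γ : Type} [Fintype κ] [Fintype γ]
      {c : κ → Type} [∀ k, Fintype (c k)] [∀ k, DecidableEq (c k)]
      (K : ∀ k, γ → Matrix (c k) a ℂ) (hK : IsInstrument K)
      (N : ∀ k, ι → Matrix (c k × b) (c k × b) ℂ) (hN : ∀ k, IsLOCC (c k) b (N k)) :
      IsLOCC a b (fun i => ∑ k, ∑ j,
        (K k j ⊗ₖ (1 : Matrix b b ℂ)).conjTranspose * N k i * (K k j ⊗ₖ (1 : Matrix b b ℂ)))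
  | bob (a b : Type) [Fintype a] [DecidableEq a] [Fintype b] [DecidableEq b]
      {κ γ : Type} [Fintype κ] [Fintype γ]
      {c : κ → Type} [∀ k, Fintype (c k)] [∀ k, DecidableEq (c k)]
      (K : ∀ k, γ → Matrix (c k) b ℂ) (hK : IsInstrument K)
      (N : ∀ k, ι → Matrix (a × c k) (a × c k) ℂ) (hN : ∀ k, IsLOCC a (c k) (N k)) :
      IsLOCC a b (fun i => ∑ k, ∑ j,
        ((1 : Matrix a a ℂ) ⊗ₖ K k j).conjTranspose * N k i * ((1 : Matrix a a ℂ) ⊗ₖ K k j))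

/-- The average probability `∑ i, p i * Tr (ρ i * M i)` of identifying the state correctly, when
the state `ρ i` is prepared with probability `p i` and the measurement `M` is performed. -/
def avgSuccess {ι n : Type} [Fintype ι] [Fintype n] (p : ι → ℝ) (ρ M : ι → Matrix n n ℂ) : ℝ :=
  ∑ i, p i * ((ρ i * M i).trace).re

/-- The average success probabilities that LOCC measurements reach for the ensemble
`{(p i, ρ i)}` of states on `ℂ^a ⊗ ℂ^b`. -/
def loccValues {ι a b : Type} [Fintype ι] [DecidableEq ι] [Fintype a] [DecidableEq a]
    [Fintype b] [DecidableEq b] (p : ι → ℝ) (ρ : ι → Matrix (a × b) (a × b) ℂ) : Set ℝ :=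
  {x | ∃ M : ι → Matrix (a × b) (a × b) ℂ, IsLOCC a b M ∧ x = avgSuccess p ρ M}

/-- The local success probability: the optimum of the average success probability over all LOCC
measurements. -/
def localSuccessProb {ι a b : Type} [Fintype ι] [DecidableEq ι] [Fintype a] [DecidableEq a]
    [Fintype b] [DecidableEq b] (p : ι → ℝ) (ρ : ι → Matrix (a × b) (a × b) ℂ) : ℝ :=
  sSup (loccValues p ρ)

/-- The computational basis vector `|x y⟩` of two qubits. -/
def ket (x y : Fin 2) : Fin 2 × Fin 2 → ℂ := Pi.single (x, y) 1

/-- The Bell states `|Ψ₁⟩, |Ψ₂⟩, |Ψ₃⟩, |Ψ₄⟩`, numbered from `0` to `3`. -/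
def bellVec : Fin 4 → (Fin 2 × Fin 2 → ℂ) :=
  ![((1 / √2 : ℝ) : ℂ) • (ket 0 0 + ket 1 1),
    ((1 / √2 : ℝ) : ℂ) • (ket 0 0 - ket 1 1),
    ((1 / √2 : ℝ) : ℂ) • (ket 0 1 + ket 1 0),
    ((1 / √2 : ℝ) : ℂ) • (ket 0 1 - ket 1 0)]

/-- The noisy Bell state `l * |Ψᵢ⟩⟨Ψᵢ| + (1 - l) * ς`. -/
def noisyBell (l : ℝ) (ς : Matrix (Fin 2 × Fin 2) (Fin 2 × Fin 2) ℂ) (i : Fin 4) :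
    Matrix (Fin 2 × Fin 2) (Fin 2 × Fin 2) ℂ :=
  (l : ℂ) • proj (bellVec i) + ((1 - l : ℝ) : ℂ) • ς

/-- The vector `√((1 + ε) / 2) |00⟩ + √((1 - ε) / 2) |11⟩`. -/
def tauVec (ε : ℝ) : Fin 2 × Fin 2 → ℂ :=
  ((√((1 + ε) / 2) : ℝ) : ℂ) • ket 0 0 + ((√((1 - ε) / 2) : ℝ) : ℂ) • ket 1 1

/-- The tensor product of operators on `X₁ ⊗ Y₁` and on `X₂ ⊗ Y₂`, as an operator on
`(X₁ ⊗ X₂) ⊗ (Y₁ ⊗ Y₂)`: Alice holds `X₁ ⊗ X₂` and Bob holds `Y₁ ⊗ Y₂`. -/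
def sharedTensor {x₁ y₁ x₂ y₂ : Type} (ρ : Matrix (x₁ × y₁) (x₁ × y₁) ℂ)
    (τ : Matrix (x₂ × y₂) (x₂ × y₂) ℂ) :
    Matrix ((x₁ × x₂) × (y₁ × y₂)) ((x₁ × x₂) × (y₁ × y₂)) ℂ :=
  Matrix.reindex (Equiv.prodProdProdComm x₁ y₁ x₂ y₂) (Equiv.prodProdProdComm x₁ y₁ x₂ y₂)
    (ρ ⊗ₖ τ)

end LOCC

end

namespace LOCC

/-! Noise is harmless: the operators of a measurement sum to `1`, so `ς` contributes exactly `(1 -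
l) / 4` (`avgSuccess_noisyBell`). It remains to show that the optimum for pure Bell states is `(1 +
√(1 - ε ^ 2)) / 2`. Upper bound: LOCC operators have positive partial transpose, so any `H` for
which every `H - p i • ρ i` has positive partial transpose bounds the success by its trace
(`IsLOCC.avgSuccess_le_trace`). The certificate is `dualBell`. Lower bound: each party makes a Bell
measurement on the two local qubits. Bell labels, read as two bits (phase, parity), add under
entanglement swapping, so the parties announce the XOR of their outcomes (`exists_isLOCC_bell`). -/

variable {a b c ι n : Type}

/-! ### Partial transposes, LOCC operators and duality -/

/-- The transpose on the first tensor factor. -/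
def partialTranspose (M : Matrix (a × b) (a × b) ℂ) : Matrix (a × b) (a × b) ℂ :=
  Matrix.of fun i j => M (j.1, i.2) (i.1, j.2)

@[simp]
theorem partialTranspose_apply (M : Matrix (a × b) (a × b) ℂ) (i j : a × b) :
    partialTranspose M i j = M (j.1, i.2) (i.1, j.2) := rfl

@[simp]
theorem partialTranspose_partialTranspose (M : Matrix (a × b) (a × b) ℂ) :
    partialTranspose (partialTranspose M) = M := rfl

theorem partialTranspose_add (M N : Matrix (a × b) (a × b) ℂ) :
    partialTranspose (M + N) = partialTranspose M + partialTranspose N := rfl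

theorem partialTranspose_sub (M N : Matrix (a × b) (a × b) ℂ) :
    partialTranspose (M - N) = partialTranspose M - partialTranspose N := rfl

theorem partialTranspose_smul (r : ℂ) (M : Matrix (a × b) (a × b) ℂ) :
    partialTranspose (r • M) = r • partialTranspose M := rfl

theorem partialTranspose_zero : partialTranspose (0 : Matrix (a × b) (a × b) ℂ) = 0 := rfl

theorem partialTranspose_one [DecidableEq a] [DecidableEq b] :
    partialTranspose (1 : Matrix (a × b) (a × b) ℂ) = 1 := by
  ext ⟨i, j⟩ ⟨k, l⟩
  simp only [partialTranspose_apply, Matrix.one_apply, Prod.mk.injEq, eq_comm (a := k)]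

theorem partialTranspose_sum {κ : Type} (s : Finset κ) (M : κ → Matrix (a × b) (a × b) ℂ) :
    partialTranspose (∑ k ∈ s, M k) = ∑ k ∈ s, partialTranspose (M k) := by
  ext i j
  simp only [partialTranspose_apply, Matrix.sum_apply]

theorem trace_partialTranspose_mul [Fintype a] [Fintype b] (A B : Matrix (a × b) (a × b) ℂ) :
    (partialTranspose A * partialTranspose B).trace = (A * B).trace := by
  simp only [Matrix.trace, Matrix.diag_apply, Matrix.mul_apply, Fintype.sum_prod_type,
    partialTranspose_apply]
  rw [Finset.sum_comm]
  conv_rhs => rw [Finset.sum_comm]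
  refine Finset.sum_congr rfl fun j _ => ?_
  rw [Finset.sum_comm]

theorem trace_partialTranspose [Fintype a] [Fintype b] (A : Matrix (a × b) (a × b) ℂ) :
    (partialTranspose A).trace = A.trace := rfl

/-- Transposing the first factor replaces Alice's Kraus operator by its entrywise conjugate, so the
result is again a congruence and positivity passes through her step. Bob's operators stay unchanged.
-/
theorem partialTranspose_conj_left [Fintype a] [Fintype b] [DecidableEq b] [Fintype c]
    (K : Matrix c a ℂ) (N : Matrix (c × b) (c × b) ℂ) :
    partialTranspose ((K ⊗ₖ (1 : Matrix b b ℂ)).conjTranspose * N * (K ⊗ₖ (1 : Matrix b b ℂ))) =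
      (K.map star ⊗ₖ (1 : Matrix b b ℂ)).conjTranspose * partialTranspose N *
        (K.map star ⊗ₖ (1 : Matrix b b ℂ)) := by
  ext ⟨i, j⟩ ⟨k, l⟩
  simp only [partialTranspose_apply, Matrix.mul_apply, Fintype.sum_prod_type,
    Matrix.conjTranspose_apply, Matrix.kronecker_apply, Matrix.map_apply, Matrix.one_apply,
    mul_ite, ite_mul, mul_one, mul_zero, zero_mul, apply_ite star, star_zero, star_star,
    Finset.sum_ite_eq', Finset.mem_univ, if_true, Finset.sum_mul, Finset.sum_ite_irrel,
    Finset.sum_const_zero]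
  rw [Finset.sum_comm]
  exact Finset.sum_congr rfl fun x _ => Finset.sum_congr rfl fun y _ => by ring

theorem partialTranspose_conj_right [Fintype a] [Fintype b] [DecidableEq a] [Fintype c]
    (K : Matrix c b ℂ) (N : Matrix (a × c) (a × c) ℂ) :
    partialTranspose ((((1 : Matrix a a ℂ) ⊗ₖ K)).conjTranspose * N * ((1 : Matrix a a ℂ) ⊗ₖ K)) =
      ((1 : Matrix a a ℂ) ⊗ₖ K).conjTranspose * partialTranspose N *
        ((1 : Matrix a a ℂ) ⊗ₖ K) := by
  ext ⟨i, j⟩ ⟨k, l⟩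
  simp [Matrix.mul_apply, Fintype.sum_prod_type, Matrix.one_apply, apply_ite star,
    Finset.sum_mul, Finset.sum_ite_irrel]

/-- Measurement operators of an LOCC protocol have positive partial transpose. -/
theorem IsLOCC.posSemidef_partialTranspose [DecidableEq ι] [Fintype a] [DecidableEq a]
    [Fintype b] [DecidableEq b] {M : ι → Matrix (a × b) (a × b) ℂ} (h : IsLOCC a b M) (i : ι) :
    (partialTranspose (M i)).PosSemidef := by
  induction h with
  | announce a b i₀ =>
    dsimp only
    split_ifs
    · rw [partialTranspose_one]; exact .one
    · rw [partialTranspose_zero]; exact .zero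
  | alice a b K hK N hN ih =>
    simp only [partialTranspose_sum, partialTranspose_conj_left]
    exact Matrix.posSemidef_sum _ fun k _ => Matrix.posSemidef_sum _ fun j _ =>
      (ih k).conjTranspose_mul_mul_same _
  | bob a b K hK N hN ih =>
    simp only [partialTranspose_sum, partialTranspose_conj_right]
    exact Matrix.posSemidef_sum _ fun k _ => Matrix.posSemidef_sum _ fun j _ =>
      (ih k).conjTranspose_mul_mul_same _

/-- The measurement operators of an LOCC protocol sum up to the identity. -/
theorem IsLOCC.sum_eq_one [DecidableEq ι] [Fintype ι] [Fintype a] [DecidableEq a]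
    [Fintype b] [DecidableEq b] {M : ι → Matrix (a × b) (a × b) ℂ} (h : IsLOCC a b M) :
    ∑ i, M i = 1 := by
  induction h with
  | announce a b i₀ => simp
  | alice a b K hK N hN ih =>
    rw [Finset.sum_comm]
    simp_rw [Finset.sum_comm (s := (Finset.univ : Finset ι)), ← Matrix.sum_mul, ← Matrix.mul_sum,
      ih, Matrix.mul_one, Matrix.conjTranspose_kronecker, ← Matrix.mul_kronecker_mul,
      Matrix.conjTranspose_one, Matrix.mul_one]
    rw [← Matrix.one_kronecker_one, ← hK]
    ext i j
    simp only [Matrix.sum_apply, Matrix.kroneckerMap_apply, Finset.sum_mul]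
  | bob a b K hK N hN ih =>
    rw [Finset.sum_comm]
    simp_rw [Finset.sum_comm (s := (Finset.univ : Finset ι)), ← Matrix.sum_mul, ← Matrix.mul_sum,
      ih, Matrix.mul_one, Matrix.conjTranspose_kronecker, ← Matrix.mul_kronecker_mul,
      Matrix.conjTranspose_one, Matrix.mul_one]
    rw [← Matrix.one_kronecker_one, ← hK]
    ext i j
    simp only [Matrix.sum_apply, Matrix.kroneckerMap_apply, Finset.mul_sum]

theorem trace_mul_nonneg_of_posSemidef [Fintype n] {A B : Matrix n n ℂ} (hA : A.PosSemidef)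
    (hB : B.PosSemidef) : 0 ≤ (A * B).trace := by
  classical
  obtain ⟨C, rfl⟩ : ∃ C : Matrix n n ℂ, A = C.conjTranspose * C := by
    open scoped MatrixOrder in
    exact CStarAlgebra.nonneg_iff_eq_star_mul_self.mp hA.nonneg
  rw [Matrix.mul_assoc, Matrix.trace_mul_comm]
  exact (hB.mul_mul_conjTranspose_same C).trace_nonneg

/-- Weak duality for discrimination by measurements with positive partial transpose. -/
theorem IsLOCC.avgSuccess_le_trace [DecidableEq ι] [Fintype ι] [Fintype a] [DecidableEq a]
    [Fintype b] [DecidableEq b] {M : ι → Matrix (a × b) (a × b) ℂ} (hM : IsLOCC a b M)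
    {p : ι → ℝ} {ρ : ι → Matrix (a × b) (a × b) ℂ} {H : Matrix (a × b) (a × b) ℂ}
    (hH : ∀ i, (partialTranspose (H - (p i : ℂ) • ρ i)).PosSemidef) :
    avgSuccess p ρ M ≤ H.trace.re := by
  have hsum : H.trace = ∑ i, (H * M i).trace := by
    rw [← Matrix.trace_sum, ← Finset.mul_sum, hM.sum_eq_one, mul_one]
  rw [hsum, Complex.re_sum, avgSuccess]
  refine Finset.sum_le_sum fun i _ => ?_
  -- Positivity is used for the partial transposes of both factors; transposing both leaves the
  -- trace pairing unchanged.
  have h := trace_mul_nonneg_of_posSemidef (hH i) (hM.posSemidef_partialTranspose i)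
  rw [trace_partialTranspose_mul, Matrix.sub_mul, Matrix.smul_mul, Matrix.trace_sub,
    Matrix.trace_smul, smul_eq_mul] at h
  have := (Complex.le_def.mp h).1
  simpa [Complex.re_ofReal_mul] using this

/-- Alice and Bob apply rank-one measurements `u` and `v`, and announce a function of the two
outcomes. -/
theorem isLOCC_of_local_measurements [DecidableEq ι] [Fintype a] [DecidableEq a]
    [Fintype b] [DecidableEq b] {κ μ : Type} [Fintype κ] [Fintype μ] (u : κ → a → ℂ)
    (v : μ → b → ℂ) (hu : ∑ k, proj (u k) = 1) (hv : ∑ l, proj (v l) = 1) (f : κ → μ → ι) :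
    IsLOCC a b fun i => ∑ k, ∑ l, if i = f k l then proj (u k) ⊗ₖ proj (v l) else 0 := by
  -- The bra of `u k` is a Kraus operator into a one-dimensional system: only the classical outcome
  -- survives.
  let K : ∀ _ : κ, Unit → Matrix Unit a ℂ := fun k _ => Matrix.replicateRow Unit (star (u k))
  let L : ∀ _ : μ, Unit → Matrix Unit b ℂ := fun l _ => Matrix.replicateRow Unit (star (v l))
  have hKK (k : κ) : (K k ()).conjTranspose * K k () = proj (u k) := by
    ext i j; simp [K, proj, Matrix.mul_apply, Matrix.vecMulVec_apply]
  have hLL (l : μ) : (L l ()).conjTranspose * L l () = proj (v l) := by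
    ext i j; simp [L, proj, Matrix.mul_apply, Matrix.vecMulVec_apply]
  have hK : IsInstrument K := by simp [IsInstrument, hKK, hu]
  have hL : IsInstrument L := by simp [IsInstrument, hLL, hv]
  convert IsLOCC.alice a b K hK _ fun k => IsLOCC.bob Unit b L hL _ fun l =>
    IsLOCC.announce Unit Unit (f k l) using 2 with i
  refine Finset.sum_congr rfl fun k _ => ?_
  simp only [Finset.univ_unique, Finset.sum_singleton, Matrix.mul_sum, Matrix.sum_mul]
  refine Finset.sum_congr rfl fun l _ => ?_
  change _ = (K k () ⊗ₖ 1).conjTranspose * ((1 ⊗ₖ L l ()).conjTranspose * _ * (1 ⊗ₖ L l ())) *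
    (K k () ⊗ₖ 1)
  split_ifs
  · simp only [Matrix.conjTranspose_kronecker, Matrix.conjTranspose_one, Matrix.mul_one,
      ← Matrix.mul_kronecker_mul, Matrix.one_mul, hLL, hKK]
  · simp

theorem posSemidef_proj {n : Type*} [Fintype n] (v : n → ℂ) : (proj v).PosSemidef :=
  Matrix.posSemidef_vecMulVec_self_star v

/-! ### Products regrouped between Alice and Bob -/

section SharedTensor

variable {x₁ y₁ x₂ y₂ : Type}

@[simp]
theorem sharedTensor_apply (ρ : Matrix (x₁ × y₁) (x₁ × y₁) ℂ) (τ : Matrix (x₂ × y₂) (x₂ × y₂) ℂ)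
    (i j : (x₁ × x₂) × (y₁ × y₂)) :
    sharedTensor ρ τ i j =
      ρ (i.1.1, i.2.1) (j.1.1, j.2.1) * τ (i.1.2, i.2.2) (j.1.2, j.2.2) := rfl

theorem partialTranspose_sharedTensor (ρ : Matrix (x₁ × y₁) (x₁ × y₁) ℂ)
    (τ : Matrix (x₂ × y₂) (x₂ × y₂) ℂ) :
    partialTranspose (sharedTensor ρ τ) =
      sharedTensor (partialTranspose ρ) (partialTranspose τ) := rfl

variable [Fintype x₁] [Fintype y₁] [Fintype x₂] [Fintype y₂]

theorem trace_sharedTensor (ρ : Matrix (x₁ × y₁) (x₁ × y₁) ℂ)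
    (τ : Matrix (x₂ × y₂) (x₂ × y₂) ℂ) :
    (sharedTensor ρ τ).trace = ρ.trace * τ.trace := by
  rw [← Matrix.trace_kronecker]
  exact (Equiv.prodProdProdComm x₁ y₁ x₂ y₂).symm.sum_comp fun i => (ρ ⊗ₖ τ) i i

theorem posSemidef_sharedTensor {ρ : Matrix (x₁ × y₁) (x₁ × y₁) ℂ}
    {τ : Matrix (x₂ × y₂) (x₂ × y₂) ℂ} (hρ : ρ.PosSemidef) (hτ : τ.PosSemidef) :
    (sharedTensor ρ τ).PosSemidef := by
  classical
  exact (hρ.kronecker hτ).submatrix (Equiv.prodProdProdComm x₁ y₁ x₂ y₂).symm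

/-- The probability that a product state is found in a product vector with respect to the other
pairing of the four systems. -/
theorem trace_sharedTensor_proj_mul (w : x₁ × y₁ → ℂ) (t : x₂ × y₂ → ℂ) (u : x₁ × x₂ → ℂ)
    (v : y₁ × y₂ → ℂ) :
    (sharedTensor (proj w) (proj t) * (proj u ⊗ₖ proj v)).trace =
      (Complex.normSq (∑ i, ∑ j, star (u i) * star (v j) * w (i.1, j.1) * t (i.2, j.2)) : ℝ) := by
  rw [← Complex.mul_conj, map_sum]
  simp only [Matrix.trace, Matrix.diag_apply, Matrix.mul_apply, map_sum,
    Fintype.sum_prod_type (α₁ := x₁ × x₂), Finset.sum_mul]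
  refine Finset.sum_congr rfl fun i _ => Finset.sum_congr rfl fun j _ => ?_
  rw [Finset.mul_sum]
  refine Finset.sum_congr rfl fun k _ => ?_
  rw [Finset.mul_sum]
  refine Finset.sum_congr rfl fun m _ => ?_
  simp only [sharedTensor_apply, proj, Matrix.vecMulVec_apply, Matrix.kronecker_apply,
    Pi.star_apply, map_mul, starRingEnd_apply, star_star]
  ring

end SharedTensor

/-! ### Bell states -/

theorem ofReal_sqrt_two_inv_mul_self : ((1 / √2 : ℝ) : ℂ) * ((1 / √2 : ℝ) : ℂ) = 1 / 2 := by
  rw [← Complex.ofReal_mul, div_mul_div_comm, Real.mul_self_sqrt zero_le_two]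
  norm_num

theorem proj_real_smul {n : Type*} (r : ℝ) (v : n → ℂ) :
    proj ((r : ℂ) • v) = ((r : ℂ) * r) • proj v := by
  ext i j
  simp [proj, Matrix.vecMulVec_apply]
  ring

/-- The sign patterns of the Bell states. -/
noncomputable def bellSign : Fin 4 → (Fin 2 × Fin 2 → ℂ) :=
  ![ket 0 0 + ket 1 1, ket 0 0 - ket 1 1, ket 0 1 + ket 1 0, ket 0 1 - ket 1 0]

theorem bellVec_eq (k : Fin 4) : bellVec k = ((1 / √2 : ℝ) : ℂ) • bellSign k := by
  fin_cases k <;> rfl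

theorem proj_bellVec (k : Fin 4) : proj (bellVec k) = (1 / 2 : ℂ) • proj (bellSign k) := by
  rw [bellVec_eq, proj_real_smul, ofReal_sqrt_two_inv_mul_self]

theorem sum_proj_bellVec : ∑ k, proj (bellVec k) = 1 := by
  simp only [proj_bellVec, Fin.sum_univ_four]
  ext ⟨i, j⟩ ⟨k, l⟩
  fin_cases i <;> fin_cases j <;> fin_cases k <;> fin_cases l <;>
    simp [proj, bellSign, ket, Matrix.vecMulVec_apply] <;>
    norm_num

/-- For `k = 0` the partial transpose is half the swap, that is, `1 / 2` minus the singlet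
projector. A Pauli on Bob's qubit carries state `0` to state `k` and the singlet to state `k.rev`,
up to phase. -/
theorem partialTranspose_proj_bellVec (k : Fin 4) :
    partialTranspose (proj (bellVec k)) = (1 / 2 : ℂ) • 1 - proj (bellVec k.rev) := by
  simp only [proj_bellVec, ← smul_sub, partialTranspose_smul]
  congr 1
  ext ⟨i, j⟩ ⟨m, l⟩
  fin_cases k <;> fin_cases i <;> fin_cases j <;> fin_cases m <;> fin_cases l <;>
    simp [proj, bellSign, ket, Matrix.vecMulVec_apply, Fin.rev]

theorem posSemidef_one_sub_proj_bellVec (k : Fin 4) : (1 - proj (bellVec k)).PosSemidef := by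
  rw [← sum_proj_bellVec, ← Finset.add_sum_erase _ _ (Finset.mem_univ k), add_sub_cancel_left]
  exact Matrix.posSemidef_sum _ fun j _ => posSemidef_proj _

theorem trace_proj_bellVec (k : Fin 4) : (proj (bellVec k)).trace = 1 := by
  rw [proj_bellVec]
  fin_cases k <;>
    simp [proj, bellSign, ket, Matrix.trace, Matrix.vecMulVec_apply, Fintype.sum_prod_type,
      Pi.single_apply] <;> norm_num

/-! ### The resource state and the dual certificate -/

section Tau

variable {ε : ℝ}

theorem sqrt_mul_sqrt_tau (hε : ε ∈ Set.Icc (0 : ℝ) 1) :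
    √((1 + ε) / 2) * √((1 - ε) / 2) = √(1 - ε ^ 2) / 2 := by
  rw [← Real.sqrt_mul (by linarith [hε.1]),
    show (1 + ε) / 2 * ((1 - ε) / 2) = (1 - ε ^ 2) / 2 ^ 2 by ring,
    Real.sqrt_div (by nlinarith [hε.1, hε.2]), Real.sqrt_sq zero_le_two]

theorem trace_proj_tauVec (hε : ε ∈ Set.Icc (0 : ℝ) 1) : (proj (tauVec ε)).trace = 1 := by
  have h : √((1 + ε) / 2) * √((1 + ε) / 2) + √((1 - ε) / 2) * √((1 - ε) / 2) = 1 := by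
    rw [Real.mul_self_sqrt (by linarith [hε.1]), Real.mul_self_sqrt (by linarith [hε.2])]
    ring
  simpa [proj, tauVec, ket, Matrix.trace, Matrix.vecMulVec_apply, Fintype.sum_prod_type,
    Pi.single_apply] using congrArg (fun x : ℝ => (x : ℂ)) h

/-- Partial transposition moves the coherences of the resource to `|01⟩⟨10|` and `|10⟩⟨01|`, whose
sum is the difference of the projectors on `bellVec 2` and `bellVec 3`. Hence only the singlet
direction can be negative. -/
theorem partialTranspose_proj_tauVec (hε : ε ∈ Set.Icc (0 : ℝ) 1) :
    partialTranspose (proj (tauVec ε)) + ((√(1 - ε ^ 2) / 2 : ℝ) : ℂ) • proj (bellVec 3) =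
      proj (((√((1 + ε) / 2) : ℝ) : ℂ) • ket 0 0) + proj (((√((1 - ε) / 2) : ℝ) : ℂ) • ket 1 1) +
        ((√(1 - ε ^ 2) / 2 : ℝ) : ℂ) • proj (bellVec 2) := by
  rw [← sqrt_mul_sqrt_tau hε, proj_bellVec, proj_bellVec]
  ext ⟨i, j⟩ ⟨m, l⟩
  fin_cases i <;> fin_cases j <;> fin_cases m <;> fin_cases l <;>
    simp [proj, tauVec, bellSign, ket, Matrix.vecMulVec_apply] <;> ring

theorem posSemidef_partialTranspose_proj_tauVec (hε : ε ∈ Set.Icc (0 : ℝ) 1) :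
    (partialTranspose (proj (tauVec ε)) +
      ((√(1 - ε ^ 2) / 2 : ℝ) : ℂ) • proj (bellVec 3)).PosSemidef := by
  rw [partialTranspose_proj_tauVec hε]
  exact ((posSemidef_proj _).add (posSemidef_proj _)).add
    ((posSemidef_proj _).smul (Complex.zero_le_real.mpr (by positivity)))

/-- An optimal solution of the dual problem for the Bell states with the resource `tauVec ε`. -/
noncomputable def dualBell (ε : ℝ) :
    Matrix ((Fin 2 × Fin 2) × (Fin 2 × Fin 2)) ((Fin 2 × Fin 2) × (Fin 2 × Fin 2)) ℂ :=
  (1 / 8 : ℂ) • (sharedTensor 1 (proj (tauVec ε)) +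
    ((√(1 - ε ^ 2) : ℝ) : ℂ) • sharedTensor 1 (partialTranspose (proj (bellVec 3))))

theorem trace_dualBell (hε : ε ∈ Set.Icc (0 : ℝ) 1) :
    (dualBell ε).trace = ((1 + √(1 - ε ^ 2)) / 2 : ℝ) := by
  simp only [dualBell, Matrix.trace_smul, Matrix.trace_add, trace_sharedTensor,
    trace_partialTranspose, trace_proj_bellVec, trace_proj_tauVec hε, Matrix.trace_one,
    Fintype.card_prod, Fintype.card_fin, smul_eq_mul]
  push_cast
  ring

theorem posSemidef_partialTranspose_dualBell_sub (hε : ε ∈ Set.Icc (0 : ℝ) 1) (k : Fin 4) :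
    (partialTranspose (dualBell ε - ((1 / 4 : ℝ) : ℂ) •
      sharedTensor (proj (bellVec k)) (proj (tauVec ε)))).PosSemidef := by
  -- The `1 / 2` in the partial transpose of the Bell projector cancels the first term of
  -- `dualBell`. The singlet term is then split between the projector of `k.rev`, where it repairs
  -- the resource, and its complement.
  have h : partialTranspose (dualBell ε - ((1 / 4 : ℝ) : ℂ) •
      sharedTensor (proj (bellVec k)) (proj (tauVec ε))) =
      ((1 / 4 : ℝ) : ℂ) • (sharedTensor (proj (bellVec k.rev)) (partialTranspose (proj (tauVec ε)) +
        ((√(1 - ε ^ 2) / 2 : ℝ) : ℂ) • proj (bellVec 3)) + ((√(1 - ε ^ 2) / 2 : ℝ) : ℂ) •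
        sharedTensor (1 - proj (bellVec k.rev)) (proj (bellVec 3))) := by
    simp only [dualBell, partialTranspose_sub, partialTranspose_smul, partialTranspose_add,
      partialTranspose_sharedTensor, partialTranspose_one, partialTranspose_partialTranspose,
      partialTranspose_proj_bellVec k]
    ext i j
    simp only [Matrix.sub_apply, Matrix.add_apply, Matrix.smul_apply, sharedTensor_apply,
      smul_eq_mul]
    push_cast
    ring
  rw [h]
  have hs : (0 : ℂ) ≤ ((√(1 - ε ^ 2) / 2 : ℝ) : ℂ) := Complex.zero_le_real.mpr (by positivity)
  exact ((posSemidef_sharedTensor (posSemidef_proj _)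
    (posSemidef_partialTranspose_proj_tauVec hε)).add ((posSemidef_sharedTensor
      (posSemidef_one_sub_proj_bellVec _) (posSemidef_proj _)).smul hs)).smul
    (Complex.zero_le_real.mpr (by norm_num))

/-! ### The optimal protocol: entanglement swapping -/

/-- Entanglement swapping: the probability that the Bell measurements of Alice and Bob on the
shared Bell state `i` and the resource give `k` and the bitwise sum `i ^^^ k`. -/
theorem trace_bell_tau_mul_bell_bell (hε : ε ∈ Set.Icc (0 : ℝ) 1) (i k : Fin 4) :
    (sharedTensor (proj (bellVec i)) (proj (tauVec ε)) *
      (proj (bellVec k) ⊗ₖ proj (bellVec (i ^^^ k)))).trace = ((1 + √(1 - ε ^ 2)) / 8 : ℝ) := by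
  have hv : (√((1 + ε) / 2) + √((1 - ε) / 2)) ^ 2 = 1 + √(1 - ε ^ 2) := by
    rw [add_sq, Real.sq_sqrt (by linarith [hε.1]), Real.sq_sqrt (by linarith [hε.2]), mul_assoc,
      sqrt_mul_sqrt_tau hε]
    ring
  -- The amplitude is the sum of the two Schmidt coefficients of the resource, up to a sign that
  -- squaring removes.
  have hsum : ∀ i k : Fin 4, ∃ s : ℝ, s ^ 2 = 1 ∧ ∑ x : Fin 2 × Fin 2, ∑ y : Fin 2 × Fin 2,
      star (bellSign k x) * star (bellSign (i ^^^ k) y) * bellSign i (x.1, y.1) *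
        tauVec ε (x.2, y.2) = ((s * (√((1 + ε) / 2) + √((1 - ε) / 2)) : ℝ) : ℂ) := by
    intro i k
    fin_cases i <;> fin_cases k <;>
    first
      | refine ⟨1, by norm_num, ?_⟩
        simp [Fintype.sum_prod_type, bellSign, tauVec, ket, Pi.single_apply] <;> ring1
      | refine ⟨-1, by norm_num, ?_⟩
        simp [Fintype.sum_prod_type, bellSign, tauVec, ket, Pi.single_apply] <;> ring1
  obtain ⟨s, hs, h⟩ := hsum i k
  rw [proj_bellVec, proj_bellVec, proj_bellVec]
  have hr : sharedTensor ((1 / 2 : ℂ) • proj (bellSign i)) (proj (tauVec ε)) *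
      (((1 / 2 : ℂ) • proj (bellSign k)) ⊗ₖ ((1 / 2 : ℂ) • proj (bellSign (i ^^^ k)))) =
      (1 / 8 : ℂ) • (sharedTensor (proj (bellSign i)) (proj (tauVec ε)) *
        (proj (bellSign k) ⊗ₖ proj (bellSign (i ^^^ k)))) := by
    have : sharedTensor ((1 / 2 : ℂ) • proj (bellSign i)) (proj (tauVec ε)) =
        (1 / 2 : ℂ) • sharedTensor (proj (bellSign i)) (proj (tauVec ε)) := by
      ext x y
      simp only [sharedTensor_apply, Matrix.smul_apply, smul_eq_mul]
      ring
    rw [this, Matrix.smul_kronecker, Matrix.kronecker_smul, Matrix.smul_mul, Matrix.mul_smul,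
      Matrix.mul_smul, smul_smul, smul_smul]
    norm_num
  rw [hr, Matrix.trace_smul, trace_sharedTensor_proj_mul, h, Complex.normSq_ofReal, ← sq, mul_pow,
    hs, hv]
  push_cast
  simp only [smul_eq_mul]
  ring

theorem exists_isLOCC_bell (hε : ε ∈ Set.Icc (0 : ℝ) 1) :
    ∃ M, IsLOCC (Fin 2 × Fin 2) (Fin 2 × Fin 2) M ∧
      avgSuccess (fun _ : Fin 4 => 1 / 4)
        (fun i => sharedTensor (proj (bellVec i)) (proj (tauVec ε))) M =
        (1 + √(1 - ε ^ 2)) / 2 := by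
  refine ⟨_, isLOCC_of_local_measurements bellVec bellVec sum_proj_bellVec sum_proj_bellVec
    fun k l => k ^^^ l, ?_⟩
  -- For each `i` and `k` exactly one outcome of Bob gives the right answer, which collapses the
  -- inner sum to four terms `(1 + √(1 - ε ^ 2)) / 8`.
  have hx : ∀ i k l : Fin 4, i = k ^^^ l ↔ l = i ^^^ k := by decide
  simp only [avgSuccess, hx, Finset.sum_ite_eq', Finset.mem_univ, if_true, Finset.mul_sum,
    Matrix.trace_sum, trace_bell_tau_mul_bell_bell hε, Complex.re_sum, Complex.ofReal_re]
  simp only [Finset.sum_const, Finset.card_univ, Fintype.card_fin, nsmul_eq_mul]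
  push_cast
  ring

end Tau

/-! ### Adding the noise -/

theorem avgSuccess_noisyBell {l : ℝ} {ς : Matrix (Fin 2 × Fin 2) (Fin 2 × Fin 2) ℂ}
    (hς : ς.trace = 1) {τ : Matrix (Fin 2 × Fin 2) (Fin 2 × Fin 2) ℂ} (hτ : τ.trace = 1)
    {M : Fin 4 → Matrix ((Fin 2 × Fin 2) × (Fin 2 × Fin 2)) ((Fin 2 × Fin 2) × (Fin 2 × Fin 2)) ℂ}
    (hM : ∑ i, M i = 1) :
    avgSuccess (fun _ : Fin 4 => 1 / 4) (fun i => sharedTensor (noisyBell l ς i) τ) M =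
      (1 - l) / 4 + l * avgSuccess (fun _ : Fin 4 => 1 / 4)
        (fun i => sharedTensor (proj (bellVec i)) τ) M := by
  have hsplit (i : Fin 4) : sharedTensor (noisyBell l ς i) τ =
      (l : ℂ) • sharedTensor (proj (bellVec i)) τ + ((1 - l : ℝ) : ℂ) • sharedTensor ς τ := by
    ext x y
    simp only [noisyBell, sharedTensor_apply, Matrix.add_apply, Matrix.smul_apply, smul_eq_mul]
    ring
  have htr : ∑ i, ((sharedTensor ς τ * M i).trace).re = 1 := by
    rw [← Complex.re_sum, ← Matrix.trace_sum, ← Finset.mul_sum, hM, mul_one, trace_sharedTensor,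
      hς, hτ, mul_one, Complex.one_re]
  simp only [avgSuccess, hsplit, Matrix.add_mul, Matrix.smul_mul, Matrix.trace_add,
    Matrix.trace_smul, smul_eq_mul, Complex.add_re, Complex.re_ofReal_mul, mul_add,
    Finset.sum_add_distrib, ← Finset.mul_sum, htr]
  ring

end LOCC

theorem theorem5 (ε l : ℝ) (hε : ε ∈ Set.Icc (0 : ℝ) 1) (hl : l ∈ Set.Icc (0 : ℝ) 1)
    (ς : Matrix (Fin 2 × Fin 2) (Fin 2 × Fin 2) ℂ) (hς : LOCC.IsDensity ς) :
    LOCC.localSuccessProb (fun _ : Fin 4 => 1 / 4)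
        (fun i => LOCC.sharedTensor (LOCC.noisyBell l ς i) (LOCC.proj (LOCC.tauVec ε)))
      = (1 + l + 2 * l * √(1 - ε ^ 2)) / 4 ∧
    (1 + l + 2 * l * √(1 - ε ^ 2)) / 4 ∈ LOCC.loccValues (fun _ : Fin 4 => 1 / 4)
        (fun i => LOCC.sharedTensor (LOCC.noisyBell l ς i) (LOCC.proj (LOCC.tauVec ε))) := by
  have hτ := LOCC.trace_proj_tauVec hε
  have hmem : (1 + l + 2 * l * √(1 - ε ^ 2)) / 4 ∈ LOCC.loccValues (fun _ : Fin 4 => 1 / 4)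
      (fun i => LOCC.sharedTensor (LOCC.noisyBell l ς i) (LOCC.proj (LOCC.tauVec ε))) := by
    obtain ⟨M, hM, hval⟩ := LOCC.exists_isLOCC_bell hε
    refine ⟨M, hM, ?_⟩
    rw [LOCC.avgSuccess_noisyBell hς.2 hτ hM.sum_eq_one, hval]
    ring
  refine ⟨IsGreatest.csSup_eq ⟨hmem, ?_⟩, hmem⟩
  rintro _ ⟨M, hM, rfl⟩
  -- Duality is needed only for the noiseless ensemble; the bound is then scaled by `l ≥ 0`.
  have h := hM.avgSuccess_le_trace (p := fun _ => 1 / 4)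
    (LOCC.posSemidef_partialTranspose_dualBell_sub hε)
  rw [LOCC.trace_dualBell hε, Complex.ofReal_re] at h
  rw [LOCC.avgSuccess_noisyBell hς.2 hτ hM.sum_eq_one]
  linarith [mul_le_mul_of_nonneg_left h hl.1]
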